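/- Let $\mathcal N=\{1,\dots,N\}$ be a set of arms and let rounds be $t=0,1,2,\dots$. In round $t$ arm $i$ has a random reward $X_i(t)\in[0,1]$ with mean $\mu_i$, and a random set $A(t)\subseteq\mathcal N$ of arms is available. The pairs $(X(t),A(t))$, where $X(t)=(X_1(t),\dots,X_N(t))$, are independent over $t$, and $X(t)$ is independent of $A(t)$ in each round; the distributions of $X_i(t)$ (for each $i$) and of $A(t)$ do not depend on $t$. (Rewards of different arms in the same round may be dependent.) Write $P_{\mathbf A}(Z)=\mathbb P(A(t)=Z)$. Let $m$ be the maximal number of arms played in a round and $\mathcal S(Z)=\{S\subseteq Z:|S|\le m\}$. Let the weights satisfy $0<w_i\le w_{\max}$, where $w_{\max}>0$, and let the required minimum selection fractions satisfy $r_i\in(0,1)$. Consider the linear program in the variables $q_S(Z)\in[0,1]$, for $Z\subseteq\mathcal N$ and $S\in\mathcal S(Z)$ (an $A$-only policy): maximize $$\sum_{Z}P_{\mathbf A}(Z)\sum_{S\in\mathcal S(Z)}q_S(Z)\sum_{i\in S}w_i\mu_i$$ subject to $\sum_{Z}P_{\mathbf A}(Z)\sum_{S\in\mathcal S(Z):\,i\in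 S}q_S(Z)\ge r_i$ for all $i$ and $\sum_{S\in\mathcal S(Z)}q_S(Z)=1$ for all $Z$. Let $\mathbf q^*$ be an optimal solution and let $R^*$ be its value. The algorithm LFG with parameter $\eta>0$ plays super arms $S(0),S(1),\dots$ as follows. Let $h_i(t-1)$ be the number of rounds $k<t$ with $i\in S(k)$, and let $\hat\mu_i(t-1)$ be the average of the rewards $X_i(k)$ in these rounds. Let $\bar\mu_i(t)=\min\{\hat\mu_i(t-1)+\sqrt{3\log t/(2h_i(t-1))},\,1\}$ if $h_i(t-1)>0$, and $\bar\mu_i(t)=1$ if $h_i(t-1)=0$. Let $Q_i(0)=0$ and $Q_i(t+1)=\max\{Q_i(t)+r_i-\mathbf 1_{\{i\in S(t)\}},\,0\}$. In round $t$, after observing $A(t)$, LFG plays some $$S(t)\in\operatorname*{arg\,max}_{S\in\mathcal S(A(t))}\ \sum_{i\in S}\bigl(Q_i(t)+\eta w_i\bar\mu_i(t)\bigr)$$ and then observes the rewards of the arms in $S(t)$. Ties are broken arbitrarily as a function of what has been observed so far and, possibly, of a randomization independent of all rewards and availabilities. Then, for every finite horizon $T\ge 1$, the time-average regret of LFG satisfies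 $$R^*-\mathbb E\Bigl[\frac1T\sum_{t=0}^{T-1}\sum_{i\in S(t)}w_iX_i(t)\Bigr]\ \le\ \frac{N}{2\eta}+\frac{\beta_1\sqrt{mNT\log T}+\beta_2N}{T},$$ where $\beta_1=2\sqrt6\,w_{\max}$ and $\beta_2=\bigl(1+\frac{5\pi^2}{12}\bigr)w_{\max}$. -/

import Mathlib

open MeasureTheory ProbabilityTheory

noncomputable section

namespace SleepingBandit

/-- A set of arms, where the arms are the elements of `Fin N`. -/
abbrev ArmSet (N : ℕ) := Finset (Fin N)

variable {N : ℕ}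

/-- The feasible super arms `𝒮(Z) = {S ⊆ Z : |S| ≤ m}` when the arms in `Z` are available. -/
def superArms (m : ℕ) (Z : ArmSet N) : Finset (ArmSet N) :=
  Z.powerset.filter fun S => S.card ≤ m

section Environment

variable {Ω : Type*} [MeasurableSpace Ω]

/-- The stochastic environment: `X t ω i` is the reward of arm `i` in round `t`, a number in
`[0, 1]`, and `A t ω` is the set of arms available in round `t`. Rewards are i.i.d. over time,
so are the sets of available arms, and rewards do not depend on availability. The rewards of
different arms in the same round may depend on each other. -/
structure IsEnvironment (P : Measure Ω) (X : ℕ → Ω → Fin N → ℝ) (A : ℕ → Ω → ArmSet N) :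
    Prop where
  measurable_reward : ∀ t, Measurable (X t)
  measurable_avail : ∀ t, Measurable (A t)
  reward_mem : ∀ t ω i, X t ω i ∈ Set.Icc (0 : ℝ) 1
  /-- what happens in different rounds is (jointly) independent -/
  indep_rounds : iIndepFun (fun t ω => (X t ω, A t ω)) P
  /-- within a round, the rewards are independent of the set of available arms -/
  indep_avail : ∀ t, IndepFun (X t) (A t) P
  /-- the reward of each arm has the same distribution in every round -/
  identDistrib_reward : ∀ t i, IdentDistrib (fun ω => X t ω i) (fun ω => X 0 ω i) P P
  /-- the set of available arms has the same distribution in every round -/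
  identDistrib_avail : ∀ t, IdentDistrib (A t) (A 0) P P

/-- The mean reward `μ_i` of arm `i`. -/
def meanReward (P : Measure Ω) (X : ℕ → Ω → Fin N → ℝ) (i : Fin N) : ℝ :=
  ∫ ω, X 0 ω i ∂P

/-- The distribution of the available arms: `P_A(Z)` is the probability that exactly the arms in
`Z` are available in a round. -/
def availProb (P : Measure Ω) (A : ℕ → Ω → ArmSet N) (Z : ArmSet N) : ℝ :=
  P.real {ω | A 0 ω = Z}

end Environment

section LinearProgram

/-! In this section `p Z` is the probability that exactly the arms in `Z` are available. An
`A`-only policy is given by numbers `q Z S`, for `S ∈ 𝒮(Z)`: the probability of playing the super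
arm `S` when `Z` is available. The values of `q Z S` for `S ∉ 𝒮(Z)` are never used. -/

/-- The objective of the linear program: the mean reward per round of the `A`-only policy `q`,
where `w` are the weights and `μ` the mean rewards of the arms. -/
def lpObjective (m : ℕ) (p : ArmSet N → ℝ) (w μ : Fin N → ℝ) (q : ArmSet N → ArmSet N → ℝ) : ℝ :=
  ∑ Z, p Z * ∑ S ∈ superArms m Z, q Z S * ∑ i ∈ S, w i * μ i

/-- The constraints of the linear program: `q` is an `A`-only policy which plays each arm `i`
with probability at least `r i` in a round. -/
structure IsLPFeasible (m : ℕ) (p : ArmSet N → ℝ) (r : Fin N → ℝ)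
    (q : ArmSet N → ArmSet N → ℝ) : Prop where
  fairness : ∀ i, r i ≤ ∑ Z, p Z * ∑ S ∈ superArms m Z with i ∈ S, q Z S
  sum_eq_one : ∀ Z, ∑ S ∈ superArms m Z, q Z S = 1
  mem_Icc : ∀ Z, ∀ S ∈ superArms m Z, q Z S ∈ Set.Icc (0 : ℝ) 1

/-- `q` is an optimal solution of the linear program, i.e. an optimal `A`-only policy. -/
def IsLPOptimal (m : ℕ) (p : ArmSet N → ℝ) (w μ r : Fin N → ℝ)
    (q : ArmSet N → ArmSet N → ℝ) : Prop :=
  IsLPFeasible m p r q ∧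
    ∀ q', IsLPFeasible m p r q' → lpObjective m p w μ q' ≤ lpObjective m p w μ q

end LinearProgram

section Algorithm

/-! The quantities which the algorithm maintains along one run, in which the super arm `S t` is
played in round `t = 0, 1, 2, …` and `X t i` is the reward of arm `i` in round `t`. -/

/-- The number of times arm `i` has been played in the rounds before `t`, i.e. `h_i(t - 1)`. -/
def playCount (S : ℕ → ArmSet N) (i : Fin N) (t : ℕ) : ℕ :=
  ((Finset.range t).filter fun k => i ∈ S k).card

/-- The sample mean of the rewards of arm `i` observed before round `t`, i.e. `μ̂_i(t - 1)`; it
is `1` if the arm has not been played. -/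
def sampleMean (X : ℕ → Fin N → ℝ) (S : ℕ → ArmSet N) (i : Fin N) (t : ℕ) : ℝ :=
  if playCount S i t = 0 then 1
  else (∑ k ∈ Finset.range t with i ∈ S k, X k i) / playCount S i t

/-- The truncated UCB estimate `μ̄_i(t)` of arm `i` in round `t`; it is `1` if the arm has not
been played before round `t`. -/
def ucb (X : ℕ → Fin N → ℝ) (S : ℕ → ArmSet N) (i : Fin N) (t : ℕ) : ℝ :=
  if playCount S i t = 0 then 1
  else min (sampleMean X S i t + √(3 * Real.log t / (2 * playCount S i t))) 1

/-- The virtual queue length `Q_i(t)` of arm `i` at the beginning of round `t`, where `r i` is the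
required minimum selection fraction of arm `i`. -/
def queue (r : Fin N → ℝ) (S : ℕ → ArmSet N) (i : Fin N) : ℕ → ℝ
  | 0 => 0
  | t + 1 => max (queue r S i t + r i - if i ∈ S t then 1 else 0) 0

/-- The compound value `∑_{i ∈ B} (Q_i(t) + η w_i μ̄_i(t))` of a super arm `B` in round `t`. -/
def compoundValue (η : ℝ) (w r : Fin N → ℝ) (X : ℕ → Fin N → ℝ) (S : ℕ → ArmSet N) (t : ℕ)
    (B : ArmSet N) : ℝ :=
  ∑ i ∈ B, (queue r S i t + η * w i * ucb X S i t)

end Algorithm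

section Policy

variable {Ω Ξ : Type*}

/-- What the player knows when choosing the super arm in round `t`: the outcome `ξ` of a private
randomization, the arms available in the rounds up to and including `t`, and, for the rounds
before `t`, the super arms played together with the rewards of the played arms. -/
@[reducible] def observedHistory [MeasurableSpace Ξ] (ξ : Ω → Ξ) (X : ℕ → Ω → Fin N → ℝ)
    (A S : ℕ → Ω → ArmSet N) (t : ℕ) : MeasurableSpace Ω :=
  MeasurableSpace.comap ξ inferInstance ⊔
  (⨆ k ≤ t, MeasurableSpace.comap (A k) inferInstance) ⊔
  (⨆ k < t, MeasurableSpace.comap (S k) inferInstance) ⊔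
  (⨆ k < t, MeasurableSpace.comap (fun ω i => if i ∈ S k ω then X k ω i else 0) inferInstance)

/-- `S` is the sequence of super arms played by the LFG algorithm with parameter `η`, for rewards
`X` and available arms `A`. Ties are broken in an arbitrary way, possibly at random with the help
of `ξ`, which is independent of the environment. -/
structure IsLFG [MeasurableSpace Ω] [MeasurableSpace Ξ] (P : Measure Ω) (m : ℕ) (η : ℝ)
    (w r : Fin N → ℝ) (X : ℕ → Ω → Fin N → ℝ) (A : ℕ → Ω → ArmSet N) (ξ : Ω → Ξ)
    (S : ℕ → Ω → ArmSet N) : Prop where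
  measurable_randomization : Measurable ξ
  indep_randomization : IndepFun ξ (fun ω t => (X t ω, A t ω)) P
  /-- decisions are based on what has been observed so far -/
  nonanticipating : ∀ t, Measurable[observedHistory ξ X A S t] (S t)
  mem_superArms : ∀ t ω, S t ω ∈ superArms m (A t ω)
  /-- the super arm played maximizes the compound value over the feasible super arms -/
  isMax : ∀ t ω, ∀ B ∈ superArms m (A t ω),
    compoundValue η w r (fun k => X k ω) (fun k => S k ω) t B ≤
      compoundValue η w r (fun k => X k ω) (fun k => S k ω) t (S t ω)

end Policy

/-- The time-average regret over `T` rounds of the policy that plays the super arms `S`, relative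
to the mean reward per round `Rstar`. -/
def regret {Ω : Type*} [MeasurableSpace Ω] (P : Measure Ω) (Rstar : ℝ) (w : Fin N → ℝ)
    (X : ℕ → Ω → Fin N → ℝ) (S : ℕ → Ω → ArmSet N) (T : ℕ) : ℝ :=
  Rstar - ∫ ω, (1 / (T : ℝ)) * ∑ t ∈ Finset.range T, ∑ i ∈ S t ω, w i * X t ω i ∂P

end SleepingBandit

end

/-!
The proof combines a Lyapunov drift argument for the virtual queues with a UCB analysis.

*Drift.* Along every run, `∑_t Q_i(t) 1{i ∈ S(t)} ≤ ∑_t Q_i(t) r_i + T / 2`, because the Lyapunov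
function `Q_i² / 2` starts at `0` and stays nonnegative (`sum_queue_mul_played_le`).

*Comparison.* In each round the super arm played maximizes `∑_{i ∈ B} (Q_i(t) + η w_i μ̄_i(t))`. Hence
its value with the true means `μ_i` in place of `μ̄_i(t)` is, up to an estimation error, at least the
average value under any stationary policy `q` (`sum_queue_mul_playProb_add_le`). If `q` is feasible
for the linear program, then in expectation this average is at least `∑_i Q_i(t) r_i + η R`, with `R`
the objective value of `q`, since `Q(t)` is independent of `A(t)` (`IsLFG.integral_queue_mul_le`).
Summed over the rounds, the queue terms cancel against the drift. What is left is
`η (T R - total reward)`, bounded by `N T / 2` plus `η w_max` times the total estimation error.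

*Estimation error.* If the sample mean of arm `i` is within the confidence radius of `μ_i`, then
`μ̄_i(t)` does not underestimate `μ_i`, and overestimates it by at most twice the radius. Such
overestimates only matter in the rounds in which the arm is played, and there they add up to
`O(√(h_i(T) log T))` (`sum_exploration_le`). Cauchy-Schwarz and `∑_i h_i(T) ≤ m T` turn this into
`2 √6 √(m N T log T)`, plus `N` for the first plays. The expected number of rounds with a
larger deviation is at most `π² / 6` for each arm and direction
(`IsLFG.sum_integral_deviationIndicator_le`), which is `π² / 3 ≤ 5 π² / 12` for each arm. The sample mean is taken over adaptively chosen rounds; its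
concentration follows from Hoeffding's exponential supermartingale
(`IsLFG.integral_exp_deviation_le`) and a union bound over the play count.

*Independence.* All expectations of products rest on two facts: the past is independent of the current
round, and the past together with `A(t)`, which determines `S(t)`, is independent of `X(t)`
(`indep_pastInfo_round`, `indep_decisionInfo_reward`, `IsLFG.measurable_decisionInfo`).
-/

namespace SleepingBandit

/-! ### Independence of the current round from the past -/

section

/-- A chain of independences: `m₁` of `m₂ ⊔ m₃`, and `m₂` of `m₃`, make `m₁ ⊔ m₂` independent of `m₃`. -/
theorem indep_sup_left_of_indep_sup {Ω : Type*} {m₁ m₂ m₃ mΩ : MeasurableSpace Ω}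
    {P : Measure Ω} [IsProbabilityMeasure P] (h₁ : m₁ ≤ mΩ) (h₂ : m₂ ≤ mΩ) (h₃ : m₃ ≤ mΩ)
    (h : Indep m₁ (m₂ ⊔ m₃) P) (h' : Indep m₂ m₃ P) : Indep (m₁ ⊔ m₂) m₃ P := by
  set π : Set (Set Ω) := {s | ∃ a b, MeasurableSet[m₁] a ∧ MeasurableSet[m₂] b ∧ s = a ∩ b}
  have hgen : m₁ ⊔ m₂ = MeasurableSpace.generateFrom π := by
    apply le_antisymm
    · refine sup_le (fun s hs => ?_) (fun s hs => ?_)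
      · exact MeasurableSpace.measurableSet_generateFrom
          ⟨s, Set.univ, hs, MeasurableSet.univ, (Set.inter_univ s).symm⟩
      · exact MeasurableSpace.measurableSet_generateFrom
          ⟨Set.univ, s, MeasurableSet.univ, hs, (Set.univ_inter s).symm⟩
    · refine MeasurableSpace.generateFrom_le ?_
      rintro s ⟨a, b, ha, hb, rfl⟩
      exact MeasurableSet.inter ((le_sup_left : m₁ ≤ m₁ ⊔ m₂) a ha)
        ((le_sup_right : m₂ ≤ m₁ ⊔ m₂) b hb)
  have hπ : IsPiSystem π := by
    rintro _ ⟨a, b, ha, hb, rfl⟩ _ ⟨a', b', ha', hb', rfl⟩ -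
    exact ⟨a ∩ a', b ∩ b', MeasurableSet.inter ha ha', MeasurableSet.inter hb hb',
      Set.inter_inter_inter_comm a b a' b'⟩
  refine IndepSets.indep (sup_le h₁ h₂) h₃ hπ (@MeasurableSpace.isPiSystem_measurableSet Ω m₃) hgen
    (@MeasurableSpace.generateFrom_measurableSet Ω m₃).symm ?_
  rw [IndepSets_iff]
  rintro _ c ⟨a, b, ha, hb, rfl⟩ hc
  rw [Indep_iff] at h h'
  have hb' : MeasurableSet[m₂ ⊔ m₃] b := (le_sup_left : m₂ ≤ m₂ ⊔ m₃) b hb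
  have hc' : MeasurableSet[m₂ ⊔ m₃] c := (le_sup_right : m₃ ≤ m₂ ⊔ m₃) c hc
  rw [Set.inter_assoc, h a (b ∩ c) ha (hb'.inter hc'), h' b c hb hc, h a b ha hb', mul_assoc]

theorem measurable_ite_mem {N : ℕ} {Ω M : Type*} {_ : MeasurableSpace Ω} [MeasurableSpace M] [Zero M]
    {B : Ω → ArmSet N} (hB : Measurable B) (i : Fin N) {f : Ω → M} (hf : Measurable f) :
    Measurable fun ω => if i ∈ B ω then f ω else 0 :=
  Measurable.ite (hB (MeasurableSet.of_discrete (s := {Z | i ∈ Z}))) hf measurable_const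

variable {N : ℕ} {Ω Ξ : Type*} [MeasurableSpace Ξ] {X : ℕ → Ω → Fin N → ℝ} {A : ℕ → Ω → ArmSet N}
  {ξ : Ω → Ξ}

/-- The σ-algebra of everything that happens before round `t`: the private randomization `ξ` and,
for the rounds before `t`, the rewards of all arms (played or not) and the available arms. -/
@[reducible] def pastInfo (ξ : Ω → Ξ) (X : ℕ → Ω → Fin N → ℝ) (A : ℕ → Ω → ArmSet N) (t : ℕ) :
    MeasurableSpace Ω :=
  MeasurableSpace.comap ξ inferInstance ⊔
    ⨆ k ∈ Set.Iio t, MeasurableSpace.comap (fun ω => (X k ω, A k ω)) inferInstance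

/-- The σ-algebra on which the decision of round `t` is based: the past together with the set of
arms available in round `t`. -/
@[reducible] def decisionInfo (ξ : Ω → Ξ) (X : ℕ → Ω → Fin N → ℝ) (A : ℕ → Ω → ArmSet N) (t : ℕ) :
    MeasurableSpace Ω :=
  pastInfo ξ X A t ⊔ MeasurableSpace.comap (A t) inferInstance

theorem pastInfo_mono {s t : ℕ} (h : s ≤ t) : pastInfo ξ X A s ≤ pastInfo ξ X A t :=
  sup_le_sup_left (biSup_mono fun _ hk => lt_of_lt_of_le hk h) _

theorem comap_round_le_pastInfo {k t : ℕ} (h : k < t) :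
    MeasurableSpace.comap (fun ω => (X k ω, A k ω)) inferInstance ≤ pastInfo ξ X A t :=
  le_sup_of_le_right (le_biSup
    (fun k => MeasurableSpace.comap (fun ω => (X k ω, A k ω)) inferInstance) (Set.mem_Iio.2 h))

theorem measurable_reward_pastInfo {k t : ℕ} (h : k < t) :
    Measurable[pastInfo ξ X A t] (X k) :=
  (measurable_fst.comp (comap_measurable fun ω => (X k ω, A k ω))).mono
    (comap_round_le_pastInfo h) le_rfl

theorem measurable_avail_pastInfo {k t : ℕ} (h : k < t) :
    Measurable[pastInfo ξ X A t] (A k) :=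
  (measurable_snd.comp (comap_measurable fun ω => (X k ω, A k ω))).mono
    (comap_round_le_pastInfo h) le_rfl

theorem decisionInfo_le_pastInfo {k t : ℕ} (h : k < t) :
    decisionInfo ξ X A k ≤ pastInfo ξ X A t :=
  sup_le (pastInfo_mono h.le) (measurable_avail_pastInfo h).comap_le

variable [mΩ : MeasurableSpace Ω] {P : Measure Ω} {S : ℕ → Ω → ArmSet N} {m : ℕ} {η : ℝ}
  {w r : Fin N → ℝ}

/-- Although the player sees only the rewards of the played arms, and the earlier super arms, this is
all determined by `decisionInfo`, by induction on the round. -/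
theorem IsLFG.measurable_decisionInfo (hS : IsLFG P m η w r X A ξ S) (t : ℕ) :
    Measurable[decisionInfo ξ X A t] (S t) := by
  induction t using Nat.strong_induction_on with
  | _ t ih =>
    have hprev : ∀ k < t, Measurable[decisionInfo ξ X A t] (S k) := fun k hk =>
      (ih k hk).mono ((decisionInfo_le_pastInfo hk).trans le_sup_left) le_rfl
    refine (hS.nonanticipating t).mono ?_ le_rfl
    refine sup_le (sup_le (sup_le ?_ ?_) ?_) ?_
    · exact le_sup_left.trans le_sup_left
    · refine iSup₂_le fun k hk => ?_
      rcases hk.lt_or_eq with hk | rfl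
      · exact (measurable_avail_pastInfo hk).comap_le.trans le_sup_left
      · exact le_sup_right
    · exact iSup₂_le fun k hk => (hprev k hk).comap_le
    · refine iSup₂_le fun k hk => Measurable.comap_le ?_
      have hX : Measurable[decisionInfo ξ X A t] (X k) :=
        (measurable_reward_pastInfo hk).mono le_sup_left le_rfl
      refine @measurable_pi_lambda _ _ _ (decisionInfo ξ X A t) _ _ fun i => ?_
      exact measurable_ite_mem (hprev k hk) i ((measurable_pi_apply i).comp hX)

theorem IsLFG.measurable_pastInfo (hS : IsLFG P m η w r X A ξ S) {k t : ℕ} (h : k < t) :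
    Measurable[pastInfo ξ X A t] (S k) :=
  (hS.measurable_decisionInfo k).mono (decisionInfo_le_pastInfo h) le_rfl

theorem pastInfo_le (hXA : IsEnvironment P X A) (hξ : Measurable ξ) (t : ℕ) :
    pastInfo ξ X A t ≤ mΩ :=
  sup_le hξ.comap_le <| iSup₂_le fun k _ =>
    ((hXA.measurable_reward k).prodMk (hXA.measurable_avail k)).comap_le

theorem decisionInfo_le (hXA : IsEnvironment P X A) (hξ : Measurable ξ) (t : ℕ) :
    decisionInfo ξ X A t ≤ mΩ :=
  sup_le (pastInfo_le hXA hξ t) (hXA.measurable_avail t).comap_le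

theorem indep_pastInfo_round [IsProbabilityMeasure P] (hXA : IsEnvironment P X A)
    (hS : IsLFG P m η w r X A ξ S) (t : ℕ) :
    Indep (pastInfo ξ X A t)
      (MeasurableSpace.comap (fun ω => (X t ω, A t ω)) inferInstance) P := by
  have hmeas : ∀ k, MeasurableSpace.comap (fun ω => (X k ω, A k ω)) inferInstance ≤ mΩ :=
    fun k => ((hXA.measurable_reward k).prodMk (hXA.measurable_avail k)).comap_le
  have hround : ∀ k, MeasurableSpace.comap (fun ω => (X k ω, A k ω)) inferInstance ≤
      MeasurableSpace.comap (fun ω k => (X k ω, A k ω)) inferInstance := fun k =>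
    ((measurable_pi_apply k).comp (comap_measurable fun ω k => (X k ω, A k ω))).comap_le
  refine indep_sup_left_of_indep_sup hS.measurable_randomization.comap_le
    (iSup₂_le fun k _ => hmeas k) (hmeas t) ?_ ?_
  · exact indep_of_indep_of_le_right ((IndepFun_iff_Indep _ _ _).1 hS.indep_randomization)
      (sup_le (iSup₂_le fun k _ => hround k) (hround t))
  · have h := indep_iSup_of_disjoint hmeas ((iIndepFun_iff_iIndep _ _ _).1 hXA.indep_rounds)
      (S := Set.Iio t) (T := {t}) (by simp)
    simpa only [iSup_singleton, Set.mem_singleton_iff, iSup_iSup_eq_left] using h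

theorem indep_pastInfo_avail [IsProbabilityMeasure P] (hXA : IsEnvironment P X A)
    (hS : IsLFG P m η w r X A ξ S) (t : ℕ) :
    Indep (pastInfo ξ X A t) (MeasurableSpace.comap (A t) inferInstance) P :=
  indep_of_indep_of_le_right (indep_pastInfo_round hXA hS t)
    (measurable_snd.comp (comap_measurable fun ω => (X t ω, A t ω))).comap_le

theorem indep_decisionInfo_reward [IsProbabilityMeasure P] (hXA : IsEnvironment P X A)
    (hS : IsLFG P m η w r X A ξ S) (t : ℕ) :
    Indep (decisionInfo ξ X A t) (MeasurableSpace.comap (X t) inferInstance) P := by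
  refine indep_sup_left_of_indep_sup (pastInfo_le hXA hS.measurable_randomization t)
    (hXA.measurable_avail t).comap_le (hXA.measurable_reward t).comap_le ?_
    ((IndepFun_iff_Indep _ _ _).1 (hXA.indep_avail t).symm)
  exact indep_of_indep_of_le_right (indep_pastInfo_round hXA hS t)
    (sup_le (measurable_snd.comp (comap_measurable fun ω => (X t ω, A t ω))).comap_le
      (measurable_fst.comp (comap_measurable fun ω => (X t ω, A t ω))).comap_le)

/-- What is known when round `t` is decided is uncorrelated with the rewards of round `t`. -/
theorem integral_mul_reward [IsProbabilityMeasure P] (hXA : IsEnvironment P X A)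
    (hS : IsLFG P m η w r X A ξ S) (t : ℕ) {f : Ω → ℝ} {g : (Fin N → ℝ) → ℝ}
    (hf : Measurable[decisionInfo ξ X A t] f) (hg : Measurable g) :
    ∫ ω, f ω * g (X t ω) ∂P = (∫ ω, f ω ∂P) * ∫ ω, g (X t ω) ∂P := by
  refine IndepFun.integral_mul_eq_mul_integral (X := f) (Y := fun ω => g (X t ω)) ?_
    (hf.mono (decisionInfo_le hXA hS.measurable_randomization t) le_rfl).aestronglyMeasurable
    (hg.comp (hXA.measurable_reward t)).aestronglyMeasurable
  rw [IndepFun_iff_Indep]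
  exact indep_of_indep_of_le_left (indep_of_indep_of_le_right
    (indep_decisionInfo_reward hXA hS t) (hg.comp (comap_measurable (X t))).comap_le) hf.comap_le

/-- What happens before round `t` is uncorrelated with the set of arms available in round `t`. -/
theorem integral_mul_avail [IsProbabilityMeasure P] (hXA : IsEnvironment P X A)
    (hS : IsLFG P m η w r X A ξ S) (t : ℕ) {f : Ω → ℝ} (g : ArmSet N → ℝ)
    (hf : Measurable[pastInfo ξ X A t] f) :
    ∫ ω, f ω * g (A t ω) ∂P = (∫ ω, f ω ∂P) * ∫ ω, g (A t ω) ∂P := by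
  have hg : Measurable g := Measurable.of_discrete
  refine IndepFun.integral_mul_eq_mul_integral (X := f) (Y := fun ω => g (A t ω)) ?_
    (hf.mono (pastInfo_le hXA hS.measurable_randomization t) le_rfl).aestronglyMeasurable
    (hg.comp (hXA.measurable_avail t)).aestronglyMeasurable
  rw [IndepFun_iff_Indep]
  exact indep_of_indep_of_le_left (indep_of_indep_of_le_right
    (indep_pastInfo_avail hXA hS t) (hg.comp (comap_measurable (A t))).comap_le) hf.comap_le

end

/-! ### Virtual queues and play counts along one run -/

section

variable {N : ℕ} (S : ℕ → ArmSet N) (i : Fin N)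

theorem queue_nonneg (r : Fin N → ℝ) (t : ℕ) : 0 ≤ queue r S i t := by
  cases t with
  | zero => exact le_rfl
  | succ t => exact le_max_right _ _

theorem queue_le {r : Fin N → ℝ} (hr : r i < 1) (t : ℕ) : queue r S i t ≤ t := by
  induction t with
  | zero => simp [queue]
  | succ t ih =>
    have : (0 : ℝ) ≤ if i ∈ S t then 1 else 0 := by split_ifs <;> norm_num
    rw [queue, Nat.cast_succ]
    exact max_le (by linarith) (by positivity)

/-- Summed drift of the quadratic Lyapunov function `Q_i(t)² / 2`, which starts at `0` and stays
nonnegative. -/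
theorem sum_queue_mul_played_le {r : Fin N → ℝ} (h0 : 0 < r i) (h1 : r i < 1) (T : ℕ) :
    ∑ t ∈ Finset.range T, queue r S i t * (if i ∈ S t then 1 else 0) ≤
      ∑ t ∈ Finset.range T, queue r S i t * r i + T / 2 := by
  suffices h : queue r S i T ^ 2 / 2 + ∑ t ∈ Finset.range T, queue r S i t *
      (if i ∈ S t then 1 else 0) ≤ ∑ t ∈ Finset.range T, queue r S i t * r i + T / 2 by
    nlinarith [sq_nonneg (queue r S i T)]
  induction T with
  | zero => simp [queue]
  | succ T ih =>
    have hstep : queue r S i (T + 1) ^ 2 ≤ queue r S i T ^ 2 +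
        2 * queue r S i T * (r i - if i ∈ S T then 1 else 0) + 1 := by
      have hd : (r i - if i ∈ S T then 1 else 0) ^ 2 ≤ 1 := by
        split_ifs <;> nlinarith
      have hmax : ∀ x : ℝ, max x 0 ^ 2 ≤ x ^ 2 := fun x => by
        rcases le_total x 0 with hx | hx
        · rw [max_eq_right hx]; simpa using sq_nonneg x
        · rw [max_eq_left hx]
      rw [queue]
      refine (hmax _).trans ?_
      nlinarith
    rw [Finset.sum_range_succ, Finset.sum_range_succ, Nat.cast_succ]
    linarith

@[simp] theorem playCount_zero : playCount S i 0 = 0 := by simp [playCount]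

theorem playCount_succ (t : ℕ) :
    playCount S i (t + 1) = playCount S i t + if i ∈ S t then 1 else 0 := by
  rw [playCount, playCount, Finset.range_add_one, Finset.filter_insert]
  split_ifs with h
  · rw [Finset.card_insert_of_notMem (by simp)]
  · rfl

theorem playCount_le (t : ℕ) : playCount S i t ≤ t :=
  (Finset.card_filter_le _ _).trans (Finset.card_range t).le

/-- The bound on the excess of the upper confidence bound of arm `i` over its mean in the absence of
large deviations: `1` if the arm has not been played before round `t`, and `c / √h` if it has been
played `h > 0` times. -/
noncomputable def explorationCost (c : ℝ) (t : ℕ) : ℝ :=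
  if playCount S i t = 0 then 1 else c / √(playCount S i t)

theorem explorationCost_nonneg {c : ℝ} (hc : 0 ≤ c) (t : ℕ) : 0 ≤ explorationCost S i c t := by
  rw [explorationCost]; split_ifs <;> positivity

theorem sum_exploration_le {c : ℝ} (hc : 0 ≤ c) (T : ℕ) :
    ∑ t ∈ Finset.range T, (if i ∈ S t then explorationCost S i c t else 0) ≤
      1 + c * (2 * √(playCount S i T)) := by
  -- The inductive claim is sharper by one play. For `h = 0` the root of `h - 1` is zero.
  suffices h : ∑ t ∈ Finset.range T, (if i ∈ S t then explorationCost S i c t else 0) ≤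
      (if playCount S i T = 0 then 0 else 1) + c * (2 * √((playCount S i T : ℝ) - 1)) by
    refine h.trans (add_le_add (by split_ifs <;> norm_num) ?_)
    gcongr
    linarith
  induction T with
  | zero => simp [Real.sqrt_eq_zero_of_nonpos]
  | succ T ih =>
    rw [Finset.sum_range_succ, playCount_succ]
    by_cases hi : i ∈ S T
    · simp only [hi, if_true, Nat.cast_add, Nat.cast_one, add_sub_cancel_right, Nat.succ_ne_zero,
        if_false]
      by_cases h0 : playCount S i T = 0
      · simp only [explorationCost, h0, if_true, Nat.cast_zero, Real.sqrt_zero] at ih ⊢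
        rw [Real.sqrt_eq_zero_of_nonpos (by norm_num)] at ih
        linarith
      · simp only [h0, if_false] at ih ⊢
        rw [explorationCost, if_neg h0]
        have hpos : (1 : ℝ) ≤ playCount S i T := by
          exact_mod_cast Nat.one_le_iff_ne_zero.2 h0
        have hs : 0 < √(playCount S i T : ℝ) := Real.sqrt_pos.2 (by linarith)
        have key : 1 / √(playCount S i T : ℝ) ≤
            2 * √(playCount S i T : ℝ) - 2 * √((playCount S i T : ℝ) - 1) := by
          rw [div_le_iff₀ hs]
          have e1 := Real.sq_sqrt (show (0 : ℝ) ≤ playCount S i T by linarith)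
          have e2 := Real.sq_sqrt (show (0 : ℝ) ≤ (playCount S i T : ℝ) - 1 by linarith)
          nlinarith [sq_nonneg (√(playCount S i T : ℝ) - √((playCount S i T : ℝ) - 1))]
        have := mul_le_mul_of_nonneg_left key hc
        rw [mul_one_div] at this
        linarith
    · simpa [hi] using ih

theorem sum_playCount_le {m : ℕ} (hm : ∀ t, (S t).card ≤ m) (T : ℕ) :
    ∑ i, playCount S i T ≤ m * T := by
  induction T with
  | zero => simp
  | succ T ih =>
    simp only [playCount_succ, Finset.sum_add_distrib, Finset.sum_boole, Finset.filter_univ_mem]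
    have := hm T
    rw [mul_add]
    simp only [Nat.cast_id, mul_one]
    omega

theorem sum_sqrt_playCount_le {m : ℕ} (hm : ∀ t, (S t).card ≤ m) (T : ℕ) :
    ∑ i, √(playCount S i T : ℝ) ≤ √((m : ℝ) * N * T) := by
  apply Real.le_sqrt_of_sq_le
  refine (sq_sum_le_card_mul_sum_sq (s := Finset.univ)).trans ?_
  have h : (∑ i, (playCount S i T : ℝ)) ≤ m * T := by exact_mod_cast sum_playCount_le S hm T
  simp only [Real.sq_sqrt (Nat.cast_nonneg _), Finset.card_univ, Fintype.card_fin]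
  nlinarith [mul_le_mul_of_nonneg_left h (Nat.cast_nonneg (α := ℝ) N)]

end

/-! ### Concentration of the sample means -/

section

/-- The accumulated deviation of the observed rewards of arm `i` from `μ` before round `t`, that is
`h_i(t - 1) * (μ̂_i(t - 1) - μ)`. -/
def deviation {N : ℕ} (x : ℕ → Fin N → ℝ) (S : ℕ → ArmSet N) (i : Fin N) (μ : ℝ) (t : ℕ) : ℝ :=
  ∑ k ∈ Finset.range t with i ∈ S k, (x k i - μ)

/-- Arm `i` has been played before round `t`, and its sample mean deviates from `μ` by at least the
confidence radius: upwards if `σ = 1`, downwards if `σ = -1`. -/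
def Deviates {N : ℕ} (x : ℕ → Fin N → ℝ) (S : ℕ → ArmSet N) (i : Fin N) (μ σ : ℝ) (t : ℕ) : Prop :=
  playCount S i t ≠ 0 ∧
    playCount S i t * √(3 * Real.log t / (2 * playCount S i t)) ≤ σ * deviation x S i μ t

open Classical in
/-- The indicator of the event that arm `i` deviates in the direction `σ`. -/
noncomputable def deviationIndicator {N : ℕ} (x : ℕ → Fin N → ℝ) (S : ℕ → ArmSet N) (i : Fin N) (μ σ : ℝ)
    (t : ℕ) : ℝ :=
  if Deviates x S i μ σ t then 1 else 0

theorem deviationIndicator_nonneg {N : ℕ} (x : ℕ → Fin N → ℝ) (S : ℕ → ArmSet N) (i : Fin N)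
    (μ σ : ℝ) (t : ℕ) : 0 ≤ deviationIndicator x S i μ σ t := by
  rw [deviationIndicator]; split_ifs <;> norm_num

open Classical in
theorem deviationIndicator_eq {N : ℕ} {Ω : Type*} (X : ℕ → Ω → Fin N → ℝ)
    (S : ℕ → Ω → ArmSet N) (i : Fin N) (μ σ : ℝ) (t : ℕ) :
    (fun ω => deviationIndicator (fun k => X k ω) (fun k => S k ω) i μ σ t) =
      {ω | Deviates (fun k => X k ω) (fun k => S k ω) i μ σ t}.indicator 1 := by
  ext ω
  rw [Set.indicator_apply]
  rfl

theorem deviation_succ {N : ℕ} (x : ℕ → Fin N → ℝ) (S : ℕ → ArmSet N) (i : Fin N) (μ : ℝ) (t : ℕ) :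
    deviation x S i μ (t + 1) = deviation x S i μ t + if i ∈ S t then x t i - μ else 0 := by
  rw [deviation, deviation, Finset.sum_filter, Finset.sum_filter, Finset.sum_range_succ]

theorem abs_deviation_le {N : ℕ} {x : ℕ → Fin N → ℝ} (S : ℕ → ArmSet N) {i : Fin N} {μ : ℝ}
    (hx : ∀ k, x k i ∈ Set.Icc (0 : ℝ) 1) (hμ : μ ∈ Set.Icc (0 : ℝ) 1) (t : ℕ) :
    |deviation x S i μ t| ≤ t := by
  induction t with
  | zero => simp [deviation]
  | succ t ih =>
    rw [deviation_succ, Nat.cast_succ]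
    refine (abs_add_le _ _).trans (add_le_add ih ?_)
    split_ifs
    · exact abs_le.2 ⟨by linarith [(hx t).1, hμ.2], by linarith [(hx t).2, hμ.1]⟩
    · simp

section

variable {N : ℕ} {Ω : Type*} {_ : MeasurableSpace Ω} {S : ℕ → Ω → ArmSet N}

theorem measurable_playCount_of_lt (i : Fin N) {t : ℕ} (hS : ∀ k < t, Measurable (S k)) :
    Measurable fun ω => playCount (fun k => S k ω) i t := by
  induction t with
  | zero => simp
  | succ t ih =>
    simp only [playCount_succ]
    exact (ih fun k hk => hS k (hk.trans t.lt_succ_self)).add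
      (measurable_ite_mem (hS t t.lt_succ_self) i measurable_const)

theorem measurable_deviation_of_lt {X : ℕ → Ω → Fin N → ℝ} (i : Fin N) (μ : ℝ) {t : ℕ}
    (hX : ∀ k < t, Measurable (X k)) (hS : ∀ k < t, Measurable (S k)) :
    Measurable fun ω => deviation (fun k => X k ω) (fun k => S k ω) i μ t := by
  induction t with
  | zero => simp [deviation]
  | succ t ih =>
    simp only [deviation_succ]
    exact (ih (fun k hk => hX k (hk.trans t.lt_succ_self))
      fun k hk => hS k (hk.trans t.lt_succ_self)).add (measurable_ite_mem (hS t t.lt_succ_self) i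
        (((measurable_pi_apply i).comp (hX t t.lt_succ_self)).sub_const μ))

theorem measurable_queue_of_lt (r : Fin N → ℝ) (i : Fin N) {t : ℕ}
    (hS : ∀ k < t, Measurable (S k)) : Measurable fun ω => queue r (fun k => S k ω) i t := by
  induction t with
  | zero => exact measurable_const
  | succ t ih =>
    simp only [queue]
    exact (((ih fun k hk => hS k (hk.trans t.lt_succ_self)).add_const _).sub
      (measurable_ite_mem (hS t t.lt_succ_self) i measurable_const)).max measurable_const

end

variable {N : ℕ} {Ω Ξ : Type*} [MeasurableSpace Ξ] [mΩ : MeasurableSpace Ω] {P : Measure Ω}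
  {X : ℕ → Ω → Fin N → ℝ} {A : ℕ → Ω → ArmSet N} {ξ : Ω → Ξ} {S : ℕ → Ω → ArmSet N} {m : ℕ}
  {η : ℝ} {w r : Fin N → ℝ}

theorem IsLFG.measurable_playCount (hS : IsLFG P m η w r X A ξ S) (i : Fin N) (t : ℕ) :
    Measurable[pastInfo ξ X A t] fun ω => playCount (fun k => S k ω) i t :=
  measurable_playCount_of_lt i fun _ hk => hS.measurable_pastInfo hk

theorem IsLFG.measurable_deviation (hS : IsLFG P m η w r X A ξ S) (i : Fin N) (μ : ℝ) (t : ℕ) :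
    Measurable[pastInfo ξ X A t] fun ω => deviation (fun k => X k ω) (fun k => S k ω) i μ t :=
  measurable_deviation_of_lt i μ (fun _ hk => measurable_reward_pastInfo hk)
    fun _ hk => hS.measurable_pastInfo hk

theorem IsLFG.measurable_queue (hS : IsLFG P m η w r X A ξ S) (i : Fin N) (t : ℕ) :
    Measurable[pastInfo ξ X A t] fun ω => queue r (fun k => S k ω) i t :=
  measurable_queue_of_lt r i fun _ hk => hS.measurable_pastInfo hk

/-- The indicator that arm `i` is played in round `t` is known when round `t` is decided. -/
theorem IsLFG.measurable_played (hS : IsLFG P m η w r X A ξ S) (i : Fin N) (t : ℕ) :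
    Measurable[decisionInfo ξ X A t] fun ω => if i ∈ S t ω then (1 : ℝ) else 0 :=
  measurable_ite_mem (hS.measurable_decisionInfo t) i
    (@measurable_const _ _ _ (decisionInfo ξ X A t) _)

theorem IsLFG.measurableSet_deviates (hXA : IsEnvironment P X A) (hS : IsLFG P m η w r X A ξ S)
    (i : Fin N) (μ σ : ℝ) (t : ℕ) :
    MeasurableSet {ω | Deviates (fun k => X k ω) (fun k => S k ω) i μ σ t} := by
  have hle := pastInfo_le hXA hS.measurable_randomization t
  have hp := (hS.measurable_playCount i t).mono hle le_rfl
  have hd := (hS.measurable_deviation i μ t).mono hle le_rfl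
  refine (hp (measurableSet_singleton 0).compl).inter
    (measurableSet_le (Measurable.comp (g := fun n : ℕ => (n : ℝ) * √(3 * Real.log t / (2 * n)))
      measurable_from_nat hp) (hd.const_mul σ))

theorem integral_reward (hXA : IsEnvironment P X A) (t : ℕ) (i : Fin N) :
    ∫ ω, X t ω i ∂P = meanReward P X i :=
  (hXA.identDistrib_reward t i).integral_eq

variable [IsProbabilityMeasure P]

theorem meanReward_mem (hXA : IsEnvironment P X A) (i : Fin N) :
    meanReward P X i ∈ Set.Icc (0 : ℝ) 1 := by
  have hint : Integrable (fun ω => X 0 ω i) P :=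
    Integrable.of_bound ((measurable_pi_apply i).comp (hXA.measurable_reward 0)).aestronglyMeasurable
      1 (ae_of_all _ fun ω => by
        rw [Real.norm_of_nonneg (hXA.reward_mem 0 ω i).1]; exact (hXA.reward_mem 0 ω i).2)
  refine ⟨integral_nonneg fun ω => (hXA.reward_mem 0 ω i).1, ?_⟩
  calc ∫ ω, X 0 ω i ∂P ≤ ∫ _, (1 : ℝ) ∂P :=
        integral_mono hint (integrable_const 1) fun ω => (hXA.reward_mem 0 ω i).2
    _ = 1 := by simp

/-- Hoeffding's lemma for a reward. -/
theorem integral_exp_reward_le (hXA : IsEnvironment P X A) (t : ℕ) (i : Fin N) (l : ℝ) :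
    ∫ ω, Real.exp (l * (X t ω i - meanReward P X i) - l ^ 2 / 8) ∂P ≤ 1 := by
  have h := (hasSubgaussianMGF_of_mem_Icc (μ := P) (X := fun ω => X t ω i) (a := 0) (b := 1)
    ((measurable_pi_apply i).comp (hXA.measurable_reward t)).aemeasurable
    (ae_of_all _ fun ω => hXA.reward_mem t ω i)).mgf_le l
  rw [integral_reward hXA t i] at h
  simp only [Real.exp_sub, integral_div]
  rw [div_le_one (Real.exp_pos _)]
  refine h.trans (Real.exp_le_exp.2 (le_of_eq ?_))
  simp
  ring

/-- Hoeffding's supermartingale for the observed rewards of arm `i`. Its mean does not exceed its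
initial value `1`, because the decision to play the arm in a round does not depend on the rewards
of that round. -/
theorem IsLFG.integral_exp_deviation_le (hXA : IsEnvironment P X A)
    (hS : IsLFG P m η w r X A ξ S) (i : Fin N) (l : ℝ) (t : ℕ) :
    Integrable (fun ω => Real.exp (l * deviation (fun k => X k ω) (fun k => S k ω) i
        (meanReward P X i) t - l ^ 2 / 8 * playCount (fun k => S k ω) i t)) P ∧
      ∫ ω, Real.exp (l * deviation (fun k => X k ω) (fun k => S k ω) i (meanReward P X i) t -
        l ^ 2 / 8 * playCount (fun k => S k ω) i t) ∂P ≤ 1 := by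
  set W : ℕ → Ω → ℝ := fun t ω => Real.exp (l * deviation (fun k => X k ω) (fun k => S k ω) i
    (meanReward P X i) t - l ^ 2 / 8 * playCount (fun k => S k ω) i t) with hW
  have hmeas : ∀ t, Measurable[pastInfo ξ X A t] (W t) := fun t =>
    Measurable.comp (g := fun p : ℝ × ℕ => Real.exp (l * p.1 - l ^ 2 / 8 * p.2)) (by fun_prop)
      ((hS.measurable_deviation i _ t).prodMk (hS.measurable_playCount i t))
  have hle := hS.measurable_randomization
  have hint : ∀ t, Integrable (W t) P := fun t => by
    refine Integrable.of_bound ((hmeas t).mono (pastInfo_le hXA hle t) le_rfl).aestronglyMeasurable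
      (Real.exp (|l| * t)) (ae_of_all _ fun ω => ?_)
    rw [Real.norm_of_nonneg (Real.exp_pos _).le, Real.exp_le_exp]
    have h1 : l * deviation (fun k => X k ω) (fun k => S k ω) i (meanReward P X i) t ≤ |l| * t := by
      refine (le_abs_self _).trans ?_
      rw [abs_mul]
      exact mul_le_mul_of_nonneg_left (abs_deviation_le _ (fun k => hXA.reward_mem k ω i)
        (meanReward_mem hXA i) t) (abs_nonneg l)
    have h2 : 0 ≤ l ^ 2 / 8 * playCount (fun k => S k ω) i t := by positivity
    linarith
  refine ⟨hint t, ?_⟩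
  induction t with
  | zero => simp [deviation]
  | succ t ih =>
    set d : Ω → ℝ := fun ω => if i ∈ S t ω then 1 else 0 with hd
    have hdm : Measurable[decisionInfo ξ X A t] d := hS.measurable_played i t
    have hWd : Measurable[decisionInfo ξ X A t] fun ω => W t ω * d ω :=
      Measurable.comp (g := fun p : ℝ × ℝ => p.1 * p.2) measurable_mul
        (((hmeas t).mono le_sup_left le_rfl).prodMk hdm)
    have hd0 : ∀ ω, d ω = 0 ∨ d ω = 1 := fun ω => by
      simp only [hd]; split_ifs <;> simp
    have hintd : Integrable (fun ω => W t ω * d ω) P := by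
      refine (hint t).mono
        (hWd.mono (decisionInfo_le hXA hle t) le_rfl).aestronglyMeasurable (ae_of_all _ fun ω => ?_)
      rcases hd0 ω with h | h <;> simp [h]
    set g : (Fin N → ℝ) → ℝ := fun x => Real.exp (l * (x i - meanReward P X i) - l ^ 2 / 8) with hg
    have hgm : Measurable g := by fun_prop
    have hsplit : ∀ ω, W (t + 1) ω = (W t ω - W t ω * d ω) + W t ω * d ω * g (X t ω) := fun ω => by
      simp only [hW, hd, hg, deviation_succ, playCount_succ]
      split_ifs
      · simp only [mul_one, sub_self, zero_add]
        rw [← Real.exp_add]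
        push_cast
        ring_nf
      · simp
    have hintg : Integrable (fun ω => W t ω * d ω * g (X t ω)) P := by
      have h := (hint (t + 1)).sub ((hint t).sub hintd)
      refine h.congr (ae_of_all _ fun ω => ?_)
      simp only [Pi.sub_apply, hsplit]
      ring
    calc ∫ ω, W (t + 1) ω ∂P
        = ∫ ω, ((W t ω - W t ω * d ω) + W t ω * d ω * g (X t ω)) ∂P := by simp only [hsplit]
      _ = (∫ ω, W t ω ∂P - ∫ ω, W t ω * d ω ∂P) +
          (∫ ω, W t ω * d ω ∂P) * ∫ ω, g (X t ω) ∂P := by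
        have hdiff : Integrable (fun ω => W t ω - W t ω * d ω) P := (hint t).sub hintd
        rw [integral_add hdiff hintg, integral_sub (hint t) hintd,
          integral_mul_reward hXA hS t hWd hgm]
      _ ≤ (∫ ω, W t ω ∂P - ∫ ω, W t ω * d ω ∂P) + (∫ ω, W t ω * d ω ∂P) * 1 := by
        gcongr
        exact integral_exp_reward_le hXA t i l
      _ ≤ 1 := by linarith

/-- Chernoff bound on the event that arm `i` deviates after exactly `s` plays. -/
theorem IsLFG.measureReal_deviation_le (hXA : IsEnvironment P X A)
    (hS : IsLFG P m η w r X A ξ S) (i : Fin N) {σ : ℝ} (hσ : σ ^ 2 = 1) {t s : ℕ} (ht : t ≠ 0)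
    (hs : s ≠ 0) :
    P.real {ω | playCount (fun k => S k ω) i t = s ∧ s * √(3 * Real.log t / (2 * s)) ≤
      σ * deviation (fun k => X k ω) (fun k => S k ω) i (meanReward P X i) t} ≤ 1 / (t : ℝ) ^ 3 := by
  set c := √(3 * Real.log t / (2 * s)) with hc
  have hs' : (0 : ℝ) < s := by exact_mod_cast Nat.pos_of_ne_zero hs
  have ht' : (0 : ℝ) < t := by exact_mod_cast Nat.pos_of_ne_zero ht
  have hc2 : 2 * s * c ^ 2 = 3 * Real.log t := by
    rw [hc, Real.sq_sqrt (by have := Real.log_natCast_nonneg t; positivity)]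
    field_simp
  -- The exponent `4 * c` minimizes the Chernoff bound `exp (-(l * s * c) + l ^ 2 * s / 8)`.
  obtain ⟨hint, hle⟩ := hS.integral_exp_deviation_le hXA i (σ * (4 * c)) t
  have hM := (mul_meas_ge_le_integral_of_nonneg (ae_of_all _ fun ω => (Real.exp_pos _).le) hint
    ((t : ℝ) ^ 3)).trans hle
  rw [le_div_iff₀ (by positivity), mul_comm]
  refine (mul_le_mul_of_nonneg_left (measureReal_mono ?_) (by positivity)).trans hM
  rintro ω ⟨h1, h2⟩
  simp only [Set.mem_ofPred_eq, h1]
  have ht3 : (t : ℝ) ^ 3 = Real.exp (2 * s * c ^ 2) := by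
    rw [hc2, mul_comm, Real.exp_mul, Real.exp_log ht']
    norm_cast
  rw [ht3, Real.exp_le_exp]
  have h3 := mul_le_mul_of_nonneg_left h2 (show 0 ≤ 4 * c by positivity)
  have h4 : (σ * (4 * c)) ^ 2 / 8 * s = 2 * s * c ^ 2 := by
    rw [mul_pow, hσ]; ring
  rw [h4]
  linarith

/-- Union bound over the play count. In round `0` nothing has been played and `1 / 0 = 0` is correct. -/
theorem IsLFG.measureReal_deviates_le (hXA : IsEnvironment P X A)
    (hS : IsLFG P m η w r X A ξ S) (i : Fin N) {σ : ℝ} (hσ : σ ^ 2 = 1) (t : ℕ) :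
    P.real {ω | Deviates (fun k => X k ω) (fun k => S k ω) i (meanReward P X i) σ t} ≤
      1 / (t : ℝ) ^ 2 := by
  rcases eq_or_ne t 0 with rfl | ht
  · simp [Deviates]
  have hsub : {ω | Deviates (fun k => X k ω) (fun k => S k ω) i (meanReward P X i) σ t} ⊆
      ⋃ s ∈ Finset.Icc 1 t, {ω | playCount (fun k => S k ω) i t = s ∧
        s * √(3 * Real.log t / (2 * s)) ≤
          σ * deviation (fun k => X k ω) (fun k => S k ω) i (meanReward P X i) t} := by
    rintro ω ⟨h0, h⟩
    simp only [Set.mem_iUnion]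
    exact ⟨_, Finset.mem_Icc.2 ⟨Nat.one_le_iff_ne_zero.2 h0, playCount_le _ i t⟩, rfl, h⟩
  calc _ ≤ _ := measureReal_mono hsub (measure_ne_top P _)
    _ ≤ _ := measureReal_biUnion_finset_le _ _
    _ ≤ ∑ _s ∈ Finset.Icc 1 t, 1 / (t : ℝ) ^ 3 := Finset.sum_le_sum fun s hs =>
        hS.measureReal_deviation_le hXA i hσ ht (by have := Finset.mem_Icc.1 hs; omega)
    _ = 1 / (t : ℝ) ^ 2 := by
        have ht' : (t : ℝ) ≠ 0 := by exact_mod_cast ht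
        simp only [Finset.sum_const, Nat.card_Icc, add_tsub_cancel_right, nsmul_eq_mul]
        field_simp

theorem IsLFG.integrable_deviationIndicator (hXA : IsEnvironment P X A)
    (hS : IsLFG P m η w r X A ξ S) (i : Fin N) (μ σ : ℝ) (t : ℕ) :
    Integrable (fun ω => deviationIndicator (fun k => X k ω) (fun k => S k ω) i μ σ t) P := by
  rw [deviationIndicator_eq]
  exact (integrable_const 1).indicator (hS.measurableSet_deviates hXA i μ σ t)

/-- The expected number of rounds in which an arm deviates in a given direction. -/
theorem IsLFG.sum_integral_deviationIndicator_le (hXA : IsEnvironment P X A)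
    (hS : IsLFG P m η w r X A ξ S) (i : Fin N) {σ : ℝ} (hσ : σ ^ 2 = 1) (T : ℕ) :
    ∑ t ∈ Finset.range T, ∫ ω, deviationIndicator (fun k => X k ω) (fun k => S k ω) i
      (meanReward P X i) σ t ∂P ≤ Real.pi ^ 2 / 6 := by
  refine (Finset.sum_le_sum fun t _ => ?_).trans
    (sum_le_hasSum (Finset.range T) (fun t _ => by positivity) hasSum_zeta_two)
  rw [deviationIndicator_eq, integral_indicator_one (hS.measurableSet_deviates hXA i _ σ t)]
  exact hS.measureReal_deviates_le hXA i hσ t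

end

/-! ### The upper confidence bounds outside the deviation events -/

section

variable {N : ℕ} {x : ℕ → Fin N → ℝ} {S : ℕ → ArmSet N} {i : Fin N} {μ : ℝ} {t : ℕ}

theorem sampleMean_sub_eq (h0 : playCount S i t ≠ 0) :
    sampleMean x S i t - μ = deviation x S i μ t / playCount S i t := by
  have h : (playCount S i t : ℝ) ≠ 0 := by exact_mod_cast h0
  rw [sampleMean, if_neg h0, deviation, Finset.sum_sub_distrib, Finset.sum_const, nsmul_eq_mul,
    ← playCount]
  field_simp

theorem ucb_le_one : ucb x S i t ≤ 1 := by
  rw [ucb]; split_ifs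
  · exact le_rfl
  · exact min_le_right _ _

theorem ucb_nonneg (hx : ∀ k, x k i ∈ Set.Icc (0 : ℝ) 1) : 0 ≤ ucb x S i t := by
  rw [ucb]; split_ifs with h0
  · exact zero_le_one
  · refine le_min (add_nonneg ?_ (Real.sqrt_nonneg _)) zero_le_one
    rw [sampleMean, if_neg h0]
    exact div_nonneg (Finset.sum_nonneg fun k _ => (hx k).1) (Nat.cast_nonneg _)

theorem le_ucb_add (hx : ∀ k, x k i ∈ Set.Icc (0 : ℝ) 1) (hμ : μ ∈ Set.Icc (0 : ℝ) 1) :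
    μ ≤ ucb x S i t + deviationIndicator x S i μ (-1) t := by
  rw [deviationIndicator]
  split_ifs with hdev
  · linarith [ucb_nonneg (S := S) (t := t) hx, hμ.2]
  rw [add_zero, ucb]
  split_ifs with h0
  · exact hμ.2
  refine le_min ?_ hμ.2
  have hpos : (0 : ℝ) < playCount S i t := by exact_mod_cast Nat.pos_of_ne_zero h0
  rw [Deviates, not_and, not_le] at hdev
  have h1 : sampleMean x S i t - μ ≥ -√(3 * Real.log t / (2 * playCount S i t)) := by
    rw [sampleMean_sub_eq h0, ge_iff_le, le_div_iff₀ hpos]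
    linarith [hdev h0]
  linarith

/-- The overestimation of a mean reward; twice the confidence radius is bounded by means of the
horizon `T`. -/
theorem ucb_le (hμ : μ ∈ Set.Icc (0 : ℝ) 1) {T : ℕ} (ht : t < T) :
    ucb x S i t ≤ μ + explorationCost S i √(6 * Real.log T) t +
      deviationIndicator x S i μ 1 t := by
  have hle := ucb_le_one (x := x) (S := S) (i := i) (t := t)
  have hexp := explorationCost_nonneg S i (Real.sqrt_nonneg (6 * Real.log T)) t
  have hind := deviationIndicator_nonneg x S i μ 1 t
  by_cases h0 : playCount S i t = 0
  · have : explorationCost S i √(6 * Real.log T) t = 1 := if_pos h0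
    linarith [hμ.1]
  by_cases hdev : Deviates x S i μ 1 t
  · have : deviationIndicator x S i μ 1 t = 1 := if_pos hdev
    linarith [hμ.1]
  have hpos : (0 : ℝ) < playCount S i t := by exact_mod_cast Nat.pos_of_ne_zero h0
  rw [Deviates, not_and, not_le] at hdev
  have h1 : sampleMean x S i t - μ ≤ √(3 * Real.log t / (2 * playCount S i t)) := by
    rw [sampleMean_sub_eq h0, div_le_iff₀ hpos]
    linarith [hdev h0]
  have h2 : 2 * √(3 * Real.log t / (2 * playCount S i t)) ≤
      √(6 * Real.log T) / √(playCount S i t) := by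
    have ht0 : 0 < t := Nat.pos_of_ne_zero fun h => h0 (by rw [h, playCount_zero])
    have hlog : Real.log t ≤ Real.log T :=
      Real.log_le_log (by exact_mod_cast ht0) (by exact_mod_cast ht.le)
    have h4 : (2 : ℝ) = √4 := by
      rw [show (4 : ℝ) = 2 ^ 2 by norm_num, Real.sqrt_sq zero_le_two]
    rw [← Real.sqrt_div' _ hpos.le]
    nth_rewrite 1 [h4]
    rw [← Real.sqrt_mul (by norm_num)]
    refine Real.sqrt_le_sqrt ?_
    rw [show 4 * (3 * Real.log t / (2 * playCount S i t)) =
      6 * Real.log t / playCount S i t by field_simp; ring]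
    gcongr
  rw [ucb, if_neg h0, explorationCost, if_neg h0]
  exact (min_le_left _ _).trans (by linarith)

end

/-! ### Comparison with the stationary policy along one run -/

section

variable {N m : ℕ} {x : ℕ → Fin N → ℝ} {S : ℕ → ArmSet N} {w r μ : Fin N → ℝ} {η wmax : ℝ}

/-- A bound, in units of `w_max`, on what the estimate of the mean `μ` of arm `i` costs in round `t`:
`1` for a deviation in either direction, and the exploration cost if the arm is played. -/
noncomputable def estimationError (x : ℕ → Fin N → ℝ) (S : ℕ → ArmSet N) (i : Fin N) (μ c : ℝ) (t : ℕ) : ℝ :=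
  deviationIndicator x S i μ (-1) t + deviationIndicator x S i μ 1 t +
    if i ∈ S t then explorationCost S i c t else 0

/-- No feasible super arm beats the one played by more than the estimation error, when the unknown
mean rewards replace the upper confidence bounds in the compound value. -/
theorem sum_le_sum_played_add_error (hw : ∀ i, 0 < w i ∧ w i ≤ wmax) (hwmax : 0 < wmax)
    (hη : 0 < η) (hx : ∀ k i, x k i ∈ Set.Icc (0 : ℝ) 1) (hμ : ∀ i, μ i ∈ Set.Icc (0 : ℝ) 1)
    {t T : ℕ} (ht : t < T) {B : ArmSet N}
    (hB : compoundValue η w r x S t B ≤ compoundValue η w r x S t (S t)) :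
    ∑ i ∈ B, (queue r S i t + η * (w i * μ i)) ≤
      ∑ i ∈ S t, (queue r S i t + η * (w i * μ i)) +
        η * wmax * ∑ i, estimationError x S i (μ i) √(6 * Real.log T) t := by
  have hlow : ∑ i ∈ B, (queue r S i t + η * (w i * μ i)) ≤ compoundValue η w r x S t B +
      η * wmax * ∑ i, deviationIndicator x S i (μ i) (-1) t := by
    calc ∑ i ∈ B, (queue r S i t + η * (w i * μ i))
        ≤ ∑ i ∈ B, ((queue r S i t + η * w i * ucb x S i t) +
          η * wmax * deviationIndicator x S i (μ i) (-1) t) := by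
          refine Finset.sum_le_sum fun i _ => ?_
          have h1 := mul_le_mul_of_nonneg_left (le_ucb_add (S := S) (t := t) (fun k => hx k i) (hμ i))
            (mul_nonneg hη.le (hw i).1.le)
          have h2 := mul_le_mul_of_nonneg_right (mul_le_mul_of_nonneg_left (hw i).2 hη.le)
            (deviationIndicator_nonneg x S i (μ i) (-1) t)
          linarith
      _ ≤ _ := by
          rw [Finset.sum_add_distrib, ← Finset.mul_sum, compoundValue]
          gcongr
          · exact fun i _ _ => deviationIndicator_nonneg x S i (μ i) (-1) t
          · exact Finset.subset_univ B
  have hup : compoundValue η w r x S t (S t) ≤ ∑ i ∈ S t, (queue r S i t + η * (w i * μ i)) +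
      η * wmax * ∑ i, (deviationIndicator x S i (μ i) 1 t +
          if i ∈ S t then explorationCost S i √(6 * Real.log T) t else 0) := by
    calc compoundValue η w r x S t (S t)
        ≤ ∑ i ∈ S t, ((queue r S i t + η * (w i * μ i)) + η * wmax *
          (deviationIndicator x S i (μ i) 1 t + explorationCost S i √(6 * Real.log T) t)) := by
          refine Finset.sum_le_sum fun i _ => ?_
          have h1 := mul_le_mul_of_nonneg_left (ucb_le (x := x) (S := S) (i := i) (hμ i) ht)
            (mul_nonneg hη.le (hw i).1.le)
          have h2 := mul_le_mul_of_nonneg_right (mul_le_mul_of_nonneg_left (hw i).2 hη.le)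
            (add_nonneg (deviationIndicator_nonneg x S i (μ i) 1 t)
              (explorationCost_nonneg S i (Real.sqrt_nonneg (6 * Real.log T)) t))
          linarith
      _ ≤ _ := by
          rw [Finset.sum_add_distrib (s := S t), ← Finset.mul_sum,
            Finset.sum_add_distrib (f := fun i => deviationIndicator x S i (μ i) 1 t),
            Finset.sum_add_distrib (s := Finset.univ), Finset.sum_ite_mem, Finset.univ_inter]
          gcongr
          · exact fun i _ _ => deviationIndicator_nonneg x S i (μ i) 1 t
          · exact Finset.subset_univ _
  calc _ ≤ _ := hlow
    _ ≤ _ := add_le_add_left (hB.trans hup) _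
    _ = _ := by
      simp only [estimationError, Finset.sum_add_distrib]
      ring

/-- The probability with which the stationary policy `q` plays arm `i` when `Z` is available. -/
def playProb (m : ℕ) (q : ArmSet N → ArmSet N → ℝ) (i : Fin N) (Z : ArmSet N) : ℝ :=
  ∑ B ∈ superArms m Z with i ∈ B, q Z B

/-- The mean reward of the stationary policy `q` in a round in which `Z` is available. -/
def policyReward (m : ℕ) (w μ : Fin N → ℝ) (q : ArmSet N → ArmSet N → ℝ) (Z : ArmSet N) : ℝ :=
  ∑ B ∈ superArms m Z, q Z B * ∑ i ∈ B, w i * μ i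

theorem sum_mul_playProb_add (Q : Fin N → ℝ) (q : ArmSet N → ArmSet N → ℝ) (Z : ArmSet N) :
    ∑ i, Q i * playProb m q i Z + η * policyReward m w μ q Z =
      ∑ B ∈ superArms m Z, q Z B * ∑ i ∈ B, (Q i + η * (w i * μ i)) := by
  simp only [playProb, policyReward, Finset.sum_add_distrib, mul_add, Finset.mul_sum]
  congr 1
  · simp only [Finset.sum_filter]
    rw [Finset.sum_comm]
    refine Finset.sum_congr rfl fun B _ => ?_
    simp only [Finset.sum_ite_mem, Finset.univ_inter]
    exact Finset.sum_congr rfl fun i _ => mul_comm _ _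
  · exact Finset.sum_congr rfl fun B _ => Finset.sum_congr rfl fun i _ => by ring

/-- The round-`t` comparison of the stationary policy `q` with the algorithm: an average of
`sum_le_sum_played_add_error` over the super arms chosen by `q`. -/
theorem sum_queue_mul_playProb_add_le {p : ArmSet N → ℝ} {q : ArmSet N → ArmSet N → ℝ}
    (hq : IsLPFeasible m p r q) (hw : ∀ i, 0 < w i ∧ w i ≤ wmax) (hwmax : 0 < wmax)
    (hη : 0 < η) (hx : ∀ k i, x k i ∈ Set.Icc (0 : ℝ) 1) (hμ : ∀ i, μ i ∈ Set.Icc (0 : ℝ) 1)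
    {t T : ℕ} (ht : t < T) {Z : ArmSet N} (hZ : ∀ B ∈ superArms m Z,
      compoundValue η w r x S t B ≤ compoundValue η w r x S t (S t)) :
    ∑ i, queue r S i t * playProb m q i Z + η * policyReward m w μ q Z ≤
      ∑ i, queue r S i t * (if i ∈ S t then 1 else 0) +
        η * ∑ i, w i * (μ i * if i ∈ S t then 1 else 0) +
        η * wmax * ∑ i, estimationError x S i (μ i) √(6 * Real.log T) t := by
  rw [sum_mul_playProb_add]
  calc ∑ B ∈ superArms m Z, q Z B * ∑ i ∈ B, (queue r S i t + η * (w i * μ i))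
      ≤ ∑ B ∈ superArms m Z, q Z B * (∑ i ∈ S t, (queue r S i t + η * (w i * μ i)) +
        η * wmax * ∑ i, estimationError x S i (μ i) √(6 * Real.log T) t) :=
        Finset.sum_le_sum fun B hB => mul_le_mul_of_nonneg_left
          (sum_le_sum_played_add_error hw hwmax hη hx hμ ht (hZ B hB)) (hq.mem_Icc Z B hB).1
    _ = _ := by
        rw [← Finset.sum_mul, hq.sum_eq_one, one_mul]
        simp only [mul_ite, mul_one, mul_zero, Finset.sum_ite_mem, Finset.univ_inter,
          Finset.sum_add_distrib, Finset.mul_sum]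

/-- The exploration part of the estimation errors, summed over all arms and rounds. -/
theorem sum_explorationCost_le (hm : ∀ t, (S t).card ≤ m) {c : ℝ} (hc : 0 ≤ c) (T : ℕ) :
    ∑ t ∈ Finset.range T, ∑ i, (if i ∈ S t then explorationCost S i c t else 0) ≤
      N + 2 * c * √((m : ℝ) * N * T) := by
  rw [Finset.sum_comm]
  calc _ ≤ ∑ i, (1 + c * (2 * √(playCount S i T : ℝ))) :=
        Finset.sum_le_sum fun i _ => sum_exploration_le S i hc T
    _ = N + 2 * c * ∑ i, √(playCount S i T : ℝ) := by
        simp only [Finset.sum_add_distrib, Finset.mul_sum, Finset.sum_const, Finset.card_univ,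
          Fintype.card_fin, nsmul_eq_mul, mul_one]
        congr 1
        exact Finset.sum_congr rfl fun i _ => by ring
    _ ≤ _ := by
        gcongr
        exact sum_sqrt_playCount_le S hm T

/-- The comparison with the stationary policy `q`, summed over the rounds of one run. -/
theorem sum_comparison_le {p : ArmSet N → ℝ} {q : ArmSet N → ArmSet N → ℝ}
    (hq : IsLPFeasible m p r q) (hw : ∀ i, 0 < w i ∧ w i ≤ wmax) (hwmax : 0 < wmax)
    (hr : ∀ i, 0 < r i ∧ r i < 1) (hη : 0 < η) (hx : ∀ k i, x k i ∈ Set.Icc (0 : ℝ) 1)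
    (hμ : ∀ i, μ i ∈ Set.Icc (0 : ℝ) 1) {Z : ℕ → ArmSet N} (hm : ∀ t, (S t).card ≤ m)
    (hZ : ∀ t, ∀ B ∈ superArms m (Z t),
      compoundValue η w r x S t B ≤ compoundValue η w r x S t (S t)) (T : ℕ) :
    ∑ t ∈ Finset.range T, (∑ i, queue r S i t * playProb m q i (Z t) +
        η * policyReward m w μ q (Z t)) ≤
      ∑ t ∈ Finset.range T, (∑ i, queue r S i t * r i +
        η * ∑ i, w i * (μ i * if i ∈ S t then 1 else 0) + η * wmax * ∑ i,
          (deviationIndicator x S i (μ i) (-1) t + deviationIndicator x S i (μ i) 1 t)) +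
      (N * (T / 2) + η * wmax * (N + 2 * √(6 * Real.log T) * √((m : ℝ) * N * T))) := by
  have h1 := Finset.sum_le_sum fun t (ht : t ∈ Finset.range T) =>
    sum_queue_mul_playProb_add_le hq hw hwmax hη hx hμ (Finset.mem_range.1 ht) (hZ t)
  have h2 : ∑ t ∈ Finset.range T, ∑ i, queue r S i t * (if i ∈ S t then 1 else 0) ≤
      ∑ t ∈ Finset.range T, ∑ i, queue r S i t * r i + N * (T / 2) := by
    rw [Finset.sum_comm, Finset.sum_comm (t := Finset.univ)]
    refine (Finset.sum_le_sum fun i _ =>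
      sum_queue_mul_played_le S i (hr i).1 (hr i).2 T).trans (le_of_eq ?_)
    simp [Finset.sum_add_distrib]
  have h3 := mul_le_mul_of_nonneg_left
    (sum_explorationCost_le hm (Real.sqrt_nonneg (6 * Real.log T)) T) (mul_pos hη hwmax).le
  simp only [estimationError, Finset.sum_add_distrib, mul_add, ← Finset.mul_sum] at h1 h2 h3 ⊢
  linarith

end

/-! ### Expectations -/

variable {N : ℕ} {Ω Ξ : Type*} [MeasurableSpace Ξ] [mΩ : MeasurableSpace Ω] {P : Measure Ω}
  [IsProbabilityMeasure P] {X : ℕ → Ω → Fin N → ℝ} {A : ℕ → Ω → ArmSet N} {ξ : Ω → Ξ}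
  {S : ℕ → Ω → ArmSet N} {m : ℕ} {η : ℝ} {w r : Fin N → ℝ}

theorem integral_avail (hXA : IsEnvironment P X A) (t : ℕ) (g : ArmSet N → ℝ) :
    ∫ ω, g (A t ω) ∂P = ∑ Z, availProb P A Z * g Z := by
  have hA : Measurable (A 0) := hXA.measurable_avail 0
  have hg : Measurable g := Measurable.of_discrete
  have h := ((hXA.identDistrib_avail t).comp hg).integral_eq
  simp only [Function.comp_apply] at h
  have : IsProbabilityMeasure (P.map (A 0)) := Measure.isProbabilityMeasure_map hA.aemeasurable
  rw [h, ← integral_map hA.aemeasurable hg.aestronglyMeasurable, integral_fintype .of_finite]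
  refine Finset.sum_congr rfl fun Z _ => ?_
  rw [map_measureReal_apply hA (measurableSet_singleton Z)]
  rfl

theorem integrable_avail (hXA : IsEnvironment P X A) (t : ℕ) (g : ArmSet N → ℝ) :
    Integrable (fun ω => g (A t ω)) P := by
  have : IsProbabilityMeasure (P.map (A t)) :=
    Measure.isProbabilityMeasure_map (hXA.measurable_avail t).aemeasurable
  exact (Integrable.of_finite (μ := P.map (A t)) (f := g)).comp_measurable (hXA.measurable_avail t)

theorem IsLFG.integrable_queue (hXA : IsEnvironment P X A) (hS : IsLFG P m η w r X A ξ S)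
    (hr : ∀ i, 0 < r i ∧ r i < 1) (i : Fin N) (t : ℕ) :
    Integrable (fun ω => queue r (fun k => S k ω) i t) P := by
  refine Integrable.of_bound ((hS.measurable_queue i t).mono
    (pastInfo_le hXA hS.measurable_randomization t) le_rfl).aestronglyMeasurable t
    (ae_of_all _ fun ω => ?_)
  rw [Real.norm_of_nonneg (queue_nonneg _ _ _ _)]
  exact queue_le _ _ (hr i).2 t

theorem IsLFG.integrable_played (hXA : IsEnvironment P X A) (hS : IsLFG P m η w r X A ξ S)
    (i : Fin N) (t : ℕ) : Integrable (fun ω => if i ∈ S t ω then (1 : ℝ) else 0) P := by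
  refine Integrable.of_bound ((hS.measurable_played i t).mono
    (decisionInfo_le hXA hS.measurable_randomization t) le_rfl).aestronglyMeasurable 1
    (ae_of_all _ fun ω => ?_)
  split_ifs <;> simp

theorem IsLFG.integrable_queue_mul (hXA : IsEnvironment P X A) (hS : IsLFG P m η w r X A ξ S)
    (hr : ∀ i, 0 < r i ∧ r i < 1) (i : Fin N) (t : ℕ) (g : ArmSet N → ℝ) :
    Integrable (fun ω => queue r (fun k => S k ω) i t * g (A t ω)) P := by
  refine Integrable.bdd_mul (c := t) (integrable_avail hXA t g)
    (hS.integrable_queue hXA hr i t).aestronglyMeasurable (ae_of_all _ fun ω => ?_)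
  rw [Real.norm_of_nonneg (queue_nonneg _ _ _ _)]
  exact queue_le _ _ (hr i).2 t

/-- A feasible stationary policy serves each queue at a rate of at least `r i`, as the queue length
at the beginning of a round is independent of the arms available in that round. -/
theorem IsLFG.integral_queue_mul_le (hXA : IsEnvironment P X A) (hS : IsLFG P m η w r X A ξ S)
    {q : ArmSet N → ArmSet N → ℝ} (hq : IsLPFeasible m (availProb P A) r q) (i : Fin N) (t : ℕ) :
    (∫ ω, queue r (fun k => S k ω) i t ∂P) * r i ≤
      ∫ ω, queue r (fun k => S k ω) i t * playProb m q i (A t ω) ∂P := by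
  rw [integral_mul_avail hXA hS t (playProb m q i) (hS.measurable_queue i t),
    integral_avail hXA t]
  exact mul_le_mul_of_nonneg_left (hq.fairness i) (integral_nonneg fun ω => queue_nonneg _ _ _ _)

theorem IsLFG.integral_played_mul_reward (hXA : IsEnvironment P X A)
    (hS : IsLFG P m η w r X A ξ S) (i : Fin N) (t : ℕ) :
    ∫ ω, (if i ∈ S t ω then (1 : ℝ) else 0) * X t ω i ∂P =
      meanReward P X i * ∫ ω, (if i ∈ S t ω then (1 : ℝ) else 0) ∂P := by
  rw [integral_mul_reward hXA hS t (hS.measurable_played i t) (measurable_pi_apply i),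
    integral_reward hXA, mul_comm]

theorem IsLFG.integral_total_reward (hXA : IsEnvironment P X A) (hS : IsLFG P m η w r X A ξ S)
    (T : ℕ) :
    ∫ ω, (1 / (T : ℝ)) * ∑ t ∈ Finset.range T, ∑ i ∈ S t ω, w i * X t ω i ∂P =
      (1 / (T : ℝ)) * ∑ t ∈ Finset.range T, ∑ i, w i * (meanReward P X i *
        ∫ ω, (if i ∈ S t ω then (1 : ℝ) else 0) ∂P) := by
  have hint : ∀ t i, Integrable (fun ω => (if i ∈ S t ω then (1 : ℝ) else 0) * X t ω i) P :=
    fun t i => (hS.integrable_played hXA i t).mul_bdd (c := 1)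
      ((measurable_pi_apply i).comp (hXA.measurable_reward t)).aestronglyMeasurable
      (ae_of_all _ fun ω => by
        rw [Real.norm_of_nonneg (hXA.reward_mem t ω i).1]; exact (hXA.reward_mem t ω i).2)
  have hsum : ∀ t ω, ∑ i ∈ S t ω, w i * X t ω i =
      ∑ i, w i * ((if i ∈ S t ω then (1 : ℝ) else 0) * X t ω i) := fun t ω => by
    simp only [ite_mul, one_mul, zero_mul, mul_ite, mul_zero, Finset.sum_ite_mem, Finset.univ_inter]
  simp only [hsum, integral_const_mul]
  rw [integral_finsetSum _ fun t _ => integrable_finsetSum _ fun i _ => (hint t i).const_mul (w i)]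
  congr 1
  refine Finset.sum_congr rfl fun t _ => ?_
  rw [integral_finsetSum _ fun i _ => (hint t i).const_mul (w i)]
  refine Finset.sum_congr rfl fun i _ => ?_
  rw [integral_const_mul, hS.integral_played_mul_reward hXA]

/-- The total regret, scaled by `η`: the expectation of `sum_comparison_le`, in which the queue terms
cancel. -/
theorem IsLFG.lpObjective_le {wmax : ℝ} (hXA : IsEnvironment P X A) (hS : IsLFG P m η w r X A ξ S)
    {q : ArmSet N → ArmSet N → ℝ} (hq : IsLPFeasible m (availProb P A) r q)
    (hw : ∀ i, 0 < w i ∧ w i ≤ wmax) (hwmax : 0 < wmax) (hr : ∀ i, 0 < r i ∧ r i < 1)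
    (hη : 0 < η) (T : ℕ) :
    T * (η * lpObjective m (availProb P A) w (meanReward P X) q) ≤
      η * ∑ t ∈ Finset.range T, ∑ i, w i * (meanReward P X i *
        ∫ ω, (if i ∈ S t ω then (1 : ℝ) else 0) ∂P) + η * wmax * (N * (Real.pi ^ 2 / 3)) +
      (N * (T / 2) + η * wmax * (N + 2 * √(6 * Real.log T) * √((m : ℝ) * N * T))) := by
  have hQ := fun i t => hS.integrable_queue hXA hr i t
  have hd := fun i t => hS.integrable_played hXA i t
  have hdev := fun i σ t => hS.integrable_deviationIndicator hXA i (meanReward P X i) σ t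
  have hQa := fun i t => hS.integrable_queue_mul hXA hr i t (playProb m q i)
  have hb := fun t => integrable_avail hXA t (policyReward m w (meanReward P X) q)
  have i1 := fun t => integrable_finsetSum Finset.univ fun i _ => hQa i t
  have i2 := fun t => (i1 t).fun_add ((hb t).const_mul η)
  have i3 := fun t => integrable_finsetSum Finset.univ fun i _ => (hQ i t).mul_const (r i)
  have i4 := fun t => (integrable_finsetSum Finset.univ fun i _ =>
    ((hd i t).const_mul (meanReward P X i)).const_mul (w i)).const_mul η
  have i5 := fun t => (integrable_finsetSum Finset.univ fun i _ =>
    (hdev i (-1) t).fun_add (hdev i 1 t)).const_mul (η * wmax)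
  have i6 := integrable_finsetSum (Finset.range T) fun t _ => ((i3 t).fun_add (i4 t)).fun_add (i5 t)
  set K : ℝ := N * (T / 2) + η * wmax * (N + 2 * √(6 * Real.log T) * √((m : ℝ) * N * T))
  have hmono := integral_mono (integrable_finsetSum (Finset.range T) fun t _ => i2 t)
    (i6.fun_add (integrable_const K))
    fun ω => sum_comparison_le hq hw hwmax hr hη (fun k i => hXA.reward_mem k ω i)
      (meanReward_mem hXA) (fun t => (Finset.mem_filter.1 (hS.mem_superArms t ω)).2)
      (fun t => hS.isMax t ω) T
  have hL : ∑ t ∈ Finset.range T, (∑ i, (∫ ω, queue r (fun k => S k ω) i t ∂P) * r i +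
      η * lpObjective m (availProb P A) w (meanReward P X) q) ≤
      ∫ ω, ∑ t ∈ Finset.range T, (∑ i, queue r (fun k => S k ω) i t * playProb m q i (A t ω) +
        η * policyReward m w (meanReward P X) q (A t ω)) ∂P := by
    rw [integral_finsetSum _ fun t _ => i2 t]
    refine Finset.sum_le_sum fun t _ => ?_
    rw [integral_add (i1 t) ((hb t).const_mul η), integral_finsetSum _ fun i _ => hQa i t,
      integral_const_mul, integral_avail hXA t]
    exact add_le_add_left
      (Finset.sum_le_sum fun i _ => hS.integral_queue_mul_le hXA hq i t) _
  have hR : ∫ ω, (∑ t ∈ Finset.range T, (∑ i, queue r (fun k => S k ω) i t * r i +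
        η * ∑ i, w i * (meanReward P X i * if i ∈ S t ω then 1 else 0) + η * wmax * ∑ i,
          (deviationIndicator (fun k => X k ω) (fun k => S k ω) i (meanReward P X i) (-1) t +
            deviationIndicator (fun k => X k ω) (fun k => S k ω) i (meanReward P X i) 1 t)) + K) ∂P =
      ∑ t ∈ Finset.range T, (∑ i, (∫ ω, queue r (fun k => S k ω) i t ∂P) * r i +
        η * ∑ i, w i * (meanReward P X i * ∫ ω, (if i ∈ S t ω then (1 : ℝ) else 0) ∂P) +
        η * wmax * ∑ i, (∫ ω, deviationIndicator (fun k => X k ω) (fun k => S k ω) i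
          (meanReward P X i) (-1) t ∂P + ∫ ω, deviationIndicator (fun k => X k ω)
            (fun k => S k ω) i (meanReward P X i) 1 t ∂P)) + K := by
    rw [integral_add i6 (integrable_const K), integral_const, probReal_univ, one_smul,
      integral_finsetSum _ fun t _ => ((i3 t).fun_add (i4 t)).fun_add (i5 t)]
    congr 1
    refine Finset.sum_congr rfl fun t _ => ?_
    rw [integral_add ((i3 t).fun_add (i4 t)) (i5 t), integral_add (i3 t) (i4 t), integral_const_mul,
      integral_const_mul, integral_finsetSum _ fun i _ => (hQ i t).mul_const (r i),
      integral_finsetSum _ fun i _ => ((hd i t).const_mul (meanReward P X i)).const_mul (w i),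
      integral_finsetSum _ fun i _ => (hdev i (-1) t).fun_add (hdev i 1 t)]
    simp only [integral_mul_const, integral_const_mul]
    congr 2
    exact Finset.sum_congr rfl fun i _ => integral_add (hdev i (-1) t) (hdev i 1 t)
  have hdevs : ∑ t ∈ Finset.range T, ∑ i, (∫ ω, deviationIndicator (fun k => X k ω)
      (fun k => S k ω) i (meanReward P X i) (-1) t ∂P + ∫ ω, deviationIndicator (fun k => X k ω)
        (fun k => S k ω) i (meanReward P X i) 1 t ∂P) ≤ N * (Real.pi ^ 2 / 3) := by
    rw [Finset.sum_comm]
    calc _ ≤ ∑ _i : Fin N, Real.pi ^ 2 / 3 := Finset.sum_le_sum fun i _ => by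
          rw [Finset.sum_add_distrib]
          linarith [hS.sum_integral_deviationIndicator_le hXA i (σ := -1) (by norm_num) T,
            hS.sum_integral_deviationIndicator_le hXA i (σ := 1) (by norm_num) T]
      _ = _ := by simp
  have hfinal := (hL.trans hmono).trans_eq hR
  have hdevs' := mul_le_mul_of_nonneg_left hdevs (mul_pos hη hwmax).le
  rw [Finset.sum_add_distrib, Finset.sum_add_distrib, Finset.sum_add_distrib, Finset.sum_const,
    Finset.card_range, nsmul_eq_mul, ← Finset.mul_sum, ← Finset.mul_sum] at hfinal
  linarith

end SleepingBandit

theorem theorem2 {Ω Ξ : Type*} [MeasurableSpace Ω] [MeasurableSpace Ξ]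
    (P : Measure Ω) [IsProbabilityMeasure P]
    (N m : ℕ) (w r : Fin N → ℝ) (wmax η : ℝ)
    (hw : ∀ i, 0 < w i ∧ w i ≤ wmax) (hwmax : 0 < wmax)
    (hr : ∀ i, 0 < r i ∧ r i < 1) (hη : 0 < η)
    (X : ℕ → Ω → Fin N → ℝ) (A : ℕ → Ω → SleepingBandit.ArmSet N)
    (hXA : SleepingBandit.IsEnvironment P X A)
    (qstar : SleepingBandit.ArmSet N → SleepingBandit.ArmSet N → ℝ)
    (hq : SleepingBandit.IsLPOptimal m (SleepingBandit.availProb P A) w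
      (SleepingBandit.meanReward P X) r qstar)
    (ξ : Ω → Ξ) (S : ℕ → Ω → SleepingBandit.ArmSet N)
    (hS : SleepingBandit.IsLFG P m η w r X A ξ S)
    (T : ℕ) (hT : 1 ≤ T) :
    SleepingBandit.regret P
        (SleepingBandit.lpObjective m (SleepingBandit.availProb P A) w
          (SleepingBandit.meanReward P X) qstar) w X S T ≤
      (N : ℝ) / (2 * η) +
        (2 * √6 * wmax * √((m : ℝ) * N * T * Real.log T) +
          (1 + 5 * Real.pi ^ 2 / 12) * wmax * N) / T := by
  have hT' : (0 : ℝ) < T := by exact_mod_cast hT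
  have hmain := hS.lpObjective_le hXA hq.1 hw hwmax hr hη T
  rw [SleepingBandit.regret, hS.integral_total_reward hXA T]
  set V := ∑ t ∈ Finset.range T, ∑ i, w i * (SleepingBandit.meanReward P X i *
        ∫ ω, (if i ∈ S t ω then (1 : ℝ) else 0) ∂P)
  set R := SleepingBandit.lpObjective m (SleepingBandit.availProb P A) w
          (SleepingBandit.meanReward P X) qstar
  have hsqrt : √(6 * Real.log T) * √((m : ℝ) * N * T) =
      √6 * √((m : ℝ) * N * T * Real.log T) := by
    rw [← Real.sqrt_mul (mul_nonneg (by norm_num) (Real.log_natCast_nonneg T)),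
      ← Real.sqrt_mul (by norm_num)]
    ring_nf
  set K := √6 * √((m : ℝ) * N * T * Real.log T) with hK
  rw [mul_assoc 2, hsqrt] at hmain
  have hpi : 0 ≤ η * (wmax * N * Real.pi ^ 2) := by positivity
  rw [← mul_le_mul_iff_right₀ (mul_pos hη hT')]
  have hrhs : η * T * ((N : ℝ) / (2 * η) + (2 * √6 * wmax * √((m : ℝ) * N * T * Real.log T) +
          (1 + 5 * Real.pi ^ 2 / 12) * wmax * N) / T) =
      N * (T / 2) + η * (2 * wmax * K + (1 + 5 * Real.pi ^ 2 / 12) * wmax * N) := by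
    rw [hK]; field_simp
  have hlhs : η * T * (R - 1 / T * V) = T * (η * R) - η * V := by field_simp
  rw [hrhs, hlhs]
  linarith
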